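/- Let $d\ge 2$ and $n\ge 1$ be integers, and let $\otimes^d\mathbb{R}^n$ be the space of real $n\times\dots\times n$ tensors $A=(a_{i_1\dots i_d})$ with $d$ indices, with the Frobenius inner product $\langle A,A'\rangle_F=\sum_{i_1,\dots,i_d=1}^n a_{i_1\dots i_d}a'_{i_1\dots i_d}$ and norm $\|A\|_F=\sqrt{\langle A,A\rangle_F}$. For $x^{(1)},\dots,x^{(d)}\in\mathbb{R}^n$ let $x^{(1)}\otimes\dots\otimes x^{(d)}$ be the tensor with entries $x^{(1)}_{i_1}\cdots x^{(d)}_{i_d}$; the nonzero tensors of this form are called rank-one tensors. The spectral norm is $$\|A\|_2=\max_{\|x^{(1)}\|=\dots=\|x^{(d)}\|=1}\langle A,x^{(1)}\otimes\dots\otimes x^{(d)}\rangle_F,$$ where $\|\cdot\|$ is the Euclidean norm. A best rank-one approximation to $A$ is a rank-one tensor $Y$ with $\|A-Y\|_F\le\|A-X\|_F$ for all rank-one tensors $X\in\otimes^d\mathbb{R}^n$. Let $\mathrm{Sym}^d(\mathbb{R}^n)\subset\otimes^d\mathbb{R}^n$ be the subspace of symmetric tensors, i.e. those with $a_{i_{\sigma(1)}\dots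 i_{\sigma(d)}}=a_{i_1\dots i_d}$ for all indices and all permutations $\sigma$ of $\{1,\dots,d\}$. For $W=\otimes^d\mathbb{R}^n$ or $W=\mathrm{Sym}^d(\mathbb{R}^n)$, a nonzero tensor $A\in W$ is called extremal in $W$ if $$\frac{\|A\|_2}{\|A\|_F}=\min_{0\ne B\in W}\frac{\|B\|_2}{\|B\|_F}.$$ Then: 1. Every tensor that is extremal in $\otimes^d\mathbb{R}^n$ has at least $n$ distinct best rank-one approximations. 2. Every symmetric tensor that is extremal in $\mathrm{Sym}^d(\mathbb{R}^n)$ has at least $n$ distinct best rank-one approximations that are themselves symmetric tensors. -/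

import Mathlib

/-- The space `⊗^d ℝⁿ` of real `n × ⋯ × n` tables `A = (a_{i₁…i_d})` with `d` indices. Its
Euclidean inner product and norm are the Frobenius inner product and the Frobenius norm. -/
abbrev RealTensor (d n : ℕ) : Type := EuclideanSpace ℝ (Fin d → Fin n)

namespace RealTensor

/-- The outer product `x⁽¹⁾ ⊗ ⋯ ⊗ x⁽ᵈ⁾`, with entries `x⁽¹⁾_{i₁} ⋯ x⁽ᵈ⁾_{i_d}`. -/
noncomputable def outer {d n : ℕ} (x : Fin d → EuclideanSpace ℝ (Fin n)) : RealTensor d n :=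
  WithLp.toLp 2 fun i => ∏ j, x j (i j)

/-- Rank-one tensors: the nonzero outer products. -/
def IsRankOne {d n : ℕ} (X : RealTensor d n) : Prop :=
  X ≠ 0 ∧ ∃ x : Fin d → EuclideanSpace ℝ (Fin n), X = outer x

/-- The spectral norm `‖A‖₂`: the maximum of `⟨A, x⁽¹⁾ ⊗ ⋯ ⊗ x⁽ᵈ⁾⟩_F` over Euclidean unit
vectors `x⁽¹⁾, …, x⁽ᵈ⁾`. -/
noncomputable def spectralNorm {d n : ℕ} (A : RealTensor d n) : ℝ :=
  sSup {t : ℝ | ∃ x : Fin d → EuclideanSpace ℝ (Fin n),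
    (∀ j, ‖x j‖ = 1) ∧ t = inner ℝ A (outer x)}

/-- `Y` is a best rank-one approximation to `A`: it is of rank one and minimizes the Frobenius
distance to `A` among all rank-one tensors. -/
def IsBestRankOneApprox {d n : ℕ} (A Y : RealTensor d n) : Prop :=
  IsRankOne Y ∧ ∀ X : RealTensor d n, IsRankOne X → ‖A - Y‖ ≤ ‖A - X‖

/-- The space `Sym^d(ℝⁿ)` of symmetric tensors. -/
def sym (d n : ℕ) : Submodule ℝ (RealTensor d n) where
  carrier := {A | ∀ (σ : Equiv.Perm (Fin d)) (i : Fin d → Fin n), A (i ∘ σ) = A i}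
  zero_mem' := fun _ _ => rfl
  add_mem' := fun {A B} hA hB σ i => by simp [hA σ i, hB σ i]
  smul_mem' := fun c A hA σ i => by simp [hA σ i]

/-- The best rank-one approximation ratio of a space `W` of tensors: the minimum of
`‖A‖₂ / ‖A‖_F` over the nonzero tensors `A` in `W`. -/
noncomputable def bestRankOneRatio {d n : ℕ} (W : Submodule ℝ (RealTensor d n)) : ℝ :=
  sInf {t : ℝ | ∃ A ∈ W, A ≠ 0 ∧ t = spectralNorm A / ‖A‖}

/-- `A` is extremal in the space `W` of tensors: it is a nonzero element of `W` at which the ratio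
of the spectral and the Frobenius norm attains its minimum over the nonzero elements of `W`. -/
def IsExtremalIn {d n : ℕ} (W : Submodule ℝ (RealTensor d n)) (A : RealTensor d n) : Prop :=
  A ∈ W ∧ A ≠ 0 ∧ spectralNorm A / ‖A‖ = bestRankOneRatio W

end RealTensor

open Function Finset

namespace RealTensor

variable {d n : ℕ}

/-! ### The multilinear form of a tensor -/

/-! If `x` maximizes `|form A|` over unit tuples, `form A x • outer x` is a best rank-one
approximation. Suppose there are fewer than `n` of these. Then each mode `j` has a unit vector `v j`
orthogonal to the `j`-th factors of all maximizers. First-order optimality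
(`IsExtremalIn.inner_eq_zero`) makes `A` orthogonal to every tensor of `W` whose form vanishes at
all maximizers, in particular to any outer product with `v j` in slot `j`. So `form A` never sees
the `v j`, and adding `‖A‖₂ • outer v` does not raise the spectral norm (this uses two slots, hence
`d ≥ 2`) but does raise the Frobenius norm: a contradiction. In the symmetric case Banach's theorem
allows only diagonal maximizers to be tested, one `v` serves all modes, and outer products are
symmetrized. -/

/-- The outer product as a multilinear map. -/
noncomputable def outerMultilinear (d n : ℕ) :
    MultilinearMap ℝ (fun _ : Fin d => EuclideanSpace ℝ (Fin n)) (RealTensor d n) :=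
  (WithLp.linearEquiv 2 ℝ ((Fin d → Fin n) → ℝ)).symm.toLinearMap.compMultilinearMap
    (MultilinearMap.pi fun i => (MultilinearMap.mkPiAlgebra ℝ (Fin d) ℝ).compLinearMap
      fun j => (EuclideanSpace.proj (i j) : EuclideanSpace ℝ (Fin n) →L[ℝ] ℝ).toLinearMap)

/-- The multilinear form `x ↦ ⟨A, x⁽¹⁾ ⊗ ⋯ ⊗ x⁽ᵈ⁾⟩` of a tensor `A`. -/
noncomputable def form (A : RealTensor d n) :
    MultilinearMap ℝ (fun _ : Fin d => EuclideanSpace ℝ (Fin n)) ℝ :=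
  (innerₗ (RealTensor d n) A).compMultilinearMap (outerMultilinear d n)

theorem form_apply (A : RealTensor d n) (x : Fin d → EuclideanSpace ℝ (Fin n)) :
    form A x = inner ℝ A (outer x) := rfl

theorem form_eq_sum (A : RealTensor d n) (x : Fin d → EuclideanSpace ℝ (Fin n)) :
    form A x = ∑ i, A i * ∏ j, x j (i j) := by
  rw [form_apply, PiLp.inner_apply]
  exact Finset.sum_congr rfl fun i _ => by simp [outer, mul_comm]

theorem form_add (A B : RealTensor d n) (x : Fin d → EuclideanSpace ℝ (Fin n)) :
    form (A + B) x = form A x + form B x := by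
  simp only [form_apply, inner_add_left]

theorem form_smul (c : ℝ) (A : RealTensor d n) (x : Fin d → EuclideanSpace ℝ (Fin n)) :
    form (c • A) x = c * form A x := by
  simp only [form_apply, real_inner_smul_left]

theorem form_outer (x y : Fin d → EuclideanSpace ℝ (Fin n)) :
    form (outer x) y = ∏ j, inner ℝ (x j) (y j) := by
  simp only [form_eq_sum, PiLp.inner_apply, outer, Finset.prod_univ_sum, Fintype.piFinset_univ,
    ← Finset.prod_mul_distrib]
  refine Finset.sum_congr rfl fun i _ => Finset.prod_congr rfl fun j _ => ?_
  simp [mul_comm]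

theorem norm_outer (x : Fin d → EuclideanSpace ℝ (Fin n)) : ‖outer x‖ = ∏ j, ‖x j‖ := by
  have h : ‖outer x‖ ^ 2 = (∏ j, ‖x j‖) ^ 2 := by
    rw [← real_inner_self_eq_norm_sq, ← form_apply, form_outer, ← Finset.prod_pow]
    exact Finset.prod_congr rfl fun j _ => real_inner_self_eq_norm_sq _
  exact (pow_left_inj₀ (norm_nonneg _) (Finset.prod_nonneg fun _ _ => norm_nonneg _)
    two_ne_zero).1 h

theorem outer_smul (c : Fin d → ℝ) (x : Fin d → EuclideanSpace ℝ (Fin n)) :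
    outer (fun j => c j • x j) = (∏ j, c j) • outer x :=
  (outerMultilinear d n).map_smul_univ c x

theorem outer_update_smul (x : Fin d → EuclideanSpace ℝ (Fin n)) (j : Fin d) (c : ℝ) :
    outer (update x j (c • x j)) = c • outer x := by
  have := (outerMultilinear d n).map_update_smul x j c (x j)
  rwa [update_eq_self] at this

theorem continuous_outer :
    Continuous (outer : (Fin d → EuclideanSpace ℝ (Fin n)) → RealTensor d n) := by
  unfold outer
  fun_prop

theorem continuous_form (A : RealTensor d n) : Continuous fun x => form A x :=
  continuous_const.inner continuous_outer

/-- Tuples of unit vectors. -/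
def unitTuples (d n : ℕ) : Set (Fin d → EuclideanSpace ℝ (Fin n)) := {x | ∀ j, ‖x j‖ = 1}

theorem isCompact_unitTuples : IsCompact (unitTuples d n) := by
  have h : unitTuples d n = Set.pi Set.univ fun _ => Metric.sphere 0 1 := by
    ext x; simp [unitTuples, Set.mem_pi]
  rw [h]
  exact isCompact_univ_pi fun _ => isCompact_sphere _ _

theorem unitTuples_nonempty (hn : 0 < n) : (unitTuples d n).Nonempty :=
  ⟨fun _ => EuclideanSpace.single ⟨0, hn⟩ 1, fun _ => by simp⟩

theorem norm_outer_of_mem {x : Fin d → EuclideanSpace ℝ (Fin n)} (hx : x ∈ unitTuples d n) :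
    ‖outer x‖ = 1 := by
  rw [norm_outer]; exact Finset.prod_eq_one fun j _ => hx j

/-! ### The spectral norm -/

theorem spectralNorm_eq_sSup_image (A : RealTensor d n) :
    spectralNorm A = sSup ((fun x => form A x) '' unitTuples d n) := by
  unfold spectralNorm
  congr 1
  ext t
  simp only [Set.mem_ofPred_eq, Set.mem_image, form_apply, unitTuples]
  exact exists_congr fun x => and_congr_right fun _ => eq_comm

theorem exists_form_eq_spectralNorm (hn : 0 < n) (A : RealTensor d n) :
    ∃ x ∈ unitTuples d n, form A x = spectralNorm A := by
  obtain ⟨x, hx, h⟩ := isCompact_unitTuples.exists_sSup_image_eq (unitTuples_nonempty hn)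
    (continuous_form A).continuousOn
  exact ⟨x, hx, by rw [spectralNorm_eq_sSup_image, h]⟩

theorem form_le_spectralNorm (A : RealTensor d n) {x : Fin d → EuclideanSpace ℝ (Fin n)}
    (hx : x ∈ unitTuples d n) : form A x ≤ spectralNorm A := by
  rw [spectralNorm_eq_sSup_image]
  exact le_csSup (isCompact_unitTuples.image (continuous_form A)).bddAbove ⟨x, hx, rfl⟩

theorem abs_form_le_spectralNorm (hd : 0 < d) (A : RealTensor d n)
    {x : Fin d → EuclideanSpace ℝ (Fin n)} (hx : x ∈ unitTuples d n) :
    |form A x| ≤ spectralNorm A := by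
  refine abs_le'.2 ⟨form_le_spectralNorm A hx, ?_⟩
  have h := form_le_spectralNorm A (x := update x ⟨0, hd⟩ ((-1 : ℝ) • x ⟨0, hd⟩)) fun j => by
    rcases eq_or_ne j ⟨0, hd⟩ with rfl | hj
    · simpa using hx _
    · simpa [hj] using hx j
  rw [form_apply, outer_update_smul, real_inner_smul_right, ← form_apply] at h
  linarith

theorem spectralNorm_nonneg (hd : 0 < d) (hn : 0 < n) (A : RealTensor d n) :
    0 ≤ spectralNorm A := by
  obtain ⟨x, hx⟩ := unitTuples_nonempty (d := d) hn
  exact (abs_nonneg _).trans (abs_form_le_spectralNorm hd A hx)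

theorem outer_eq_norm_smul (x : Fin d → EuclideanSpace ℝ (Fin n)) :
    outer x = ‖outer x‖ • outer fun j => ‖x j‖⁻¹ • x j := by
  rw [norm_outer, ← outer_smul]
  congr 1
  funext j
  -- A zero factor is harmless: `0⁻¹ = 0`, and both sides vanish.
  rcases eq_or_ne (x j) 0 with h | h
  · simp [h]
  · rw [smul_smul, mul_inv_cancel₀ (norm_ne_zero_iff.2 h), one_smul]

theorem normalize_mem_unitTuples {x : Fin d → EuclideanSpace ℝ (Fin n)} (hx : outer x ≠ 0) :
    (fun j => ‖x j‖⁻¹ • x j) ∈ unitTuples d n := by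
  intro j
  have h : x j ≠ 0 := by
    rw [← norm_ne_zero_iff, norm_outer, Finset.prod_ne_zero_iff] at hx
    exact norm_ne_zero_iff.1 (hx j (Finset.mem_univ j))
  simp [norm_smul, h]

theorem abs_form_le (hd : 0 < d) (A : RealTensor d n) (x : Fin d → EuclideanSpace ℝ (Fin n)) :
    |form A x| ≤ spectralNorm A * ∏ j, ‖x j‖ := by
  rw [← norm_outer]
  rcases eq_or_ne (outer x) 0 with h | h
  · simp [form_apply, h]
  · have h1 := abs_form_le_spectralNorm hd A (normalize_mem_unitTuples h)
    rw [form_apply, outer_eq_norm_smul x, real_inner_smul_right, abs_mul, abs_norm,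
      ← outer_eq_norm_smul x, mul_comm]
    exact mul_le_mul_of_nonneg_right h1 (norm_nonneg _)

theorem spectralNorm_pos (hd : 0 < d) (hn : 0 < n) {A : RealTensor d n} (hA : A ≠ 0) :
    0 < spectralNorm A := by
  refine (spectralNorm_nonneg hd hn A).lt_of_ne fun h => hA ?_
  ext i
  have h1 : form A (fun j => EuclideanSpace.single (i j) 1) = A i := by
    rw [form_eq_sum, Finset.sum_eq_single i]
    · simp
    · intro k _ hk
      obtain ⟨j, hj⟩ := Function.ne_iff.1 hk
      rw [Finset.prod_eq_zero (Finset.mem_univ j) (by simp [hj]), mul_zero]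
    · simp
  have h2 := abs_form_le hd A fun j => EuclideanSpace.single (i j) 1
  rw [← h, zero_mul, h1] at h2
  simpa using h2

/-! ### Maximizers of the form -/

/-- A linear functional attaining its norm at the unit vector `b` is a multiple of `⟪b, ·⟫`. -/
theorem linearMap_eq_mul_inner {E : Type*} [NormedAddCommGroup E] [InnerProductSpace ℝ E]
    [FiniteDimensional ℝ E] (l : E →ₗ[ℝ] ℝ) {b : E} (hb : ‖b‖ = 1)
    (h : ∀ z, |l z| ≤ |l b| * ‖z‖) (z : E) : l z = l b * inner ℝ b z := by
  obtain ⟨g, hg⟩ : ∃ g : E, ∀ z, l z = inner ℝ g z :=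
    ⟨(InnerProductSpace.toDual ℝ E).symm (LinearMap.toContinuousLinearMap l), fun z => by simp⟩
  have h1 := h g
  rw [hg g, real_inner_self_eq_norm_sq, abs_of_nonneg (sq_nonneg _)] at h1
  have h2 : ‖g‖ ≤ |l b| := by
    rcases (norm_nonneg g).eq_or_lt with h0 | h0
    · rw [← h0]; exact abs_nonneg _
    · nlinarith
  -- The square expands to `‖g‖² - (l b)²`.
  have h3 : ‖g - l b • b‖ ^ 2 ≤ 0 := by
    rw [norm_sub_sq_real, real_inner_smul_right, ← hg b, norm_smul, hb, Real.norm_eq_abs, mul_one,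
      sq_abs]
    have := pow_le_pow_left₀ (norm_nonneg g) h2 2
    rw [sq_abs] at this
    nlinarith
  have h4 : g = l b • b := by
    rw [← sub_eq_zero, ← norm_eq_zero]
    exact pow_eq_zero_iff two_ne_zero |>.1 (le_antisymm h3 (sq_nonneg _))
  rw [hg z, h4, real_inner_smul_left]

/-- With the other slots frozen, the form is a linear functional of slot `j` that attains its norm
at `x j`. -/
theorem form_update_of_abs_form_eq (hd : 0 < d) {A : RealTensor d n}
    {x : Fin d → EuclideanSpace ℝ (Fin n)} (hx : x ∈ unitTuples d n)
    (h : |form A x| = spectralNorm A) (j : Fin d) (z : EuclideanSpace ℝ (Fin n)) :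
    form A (update x j z) = form A x * inner ℝ (x j) z := by
  have := linearMap_eq_mul_inner ((form A).toLinearMap x j) (hx j) (fun z => ?_) z
  · simpa using this
  · have h1 := abs_form_le hd A (update x j z)
    have h2 : ∏ k, ‖update x j z k‖ = ‖z‖ := by
      rw [Finset.prod_eq_single j]
      · simp
      · intro k _ hk; rw [update_of_ne hk]; exact hx k
      · simp
    rw [h2] at h1
    simpa [h] using h1

/-! ### Symmetric tensors -/

theorem form_comp_perm {A : RealTensor d n} (hA : A ∈ sym d n) (σ : Equiv.Perm (Fin d))
    (x : Fin d → EuclideanSpace ℝ (Fin n)) : form A (x ∘ σ) = form A x := by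
  rw [form_eq_sum, form_eq_sum]
  refine (Equiv.sum_comp (Equiv.arrowCongr σ.symm (Equiv.refl (Fin n))) _).symm.trans
    (Finset.sum_congr rfl fun i _ => ?_)
  congr 1
  · exact hA σ i
  · exact Equiv.prod_comp σ fun j => x j (i j)

theorem outer_const_mem_sym (x : EuclideanSpace ℝ (Fin n)) :
    outer (fun _ : Fin d => x) ∈ sym d n :=
  fun σ i => Equiv.prod_comp σ fun j => x (i j)

theorem sum_outer_comp_perm_mem_sym (x : Fin d → EuclideanSpace ℝ (Fin n)) :
    ∑ σ : Equiv.Perm (Fin d), outer (x ∘ σ) ∈ sym d n := by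
  intro τ i
  simp only [WithLp.ofLp_sum, Finset.sum_apply]
  refine (Equiv.sum_comp (Equiv.mulRight τ) _).symm.trans (Finset.sum_congr rfl fun σ _ => ?_)
  exact Equiv.prod_comp τ fun j => x (σ j) (i j)

/-- Merging two entries of a maximizer of the form of a symmetric tensor. -/
theorem form_update_update_add (hd : 0 < d) {A : RealTensor d n} (hA : A ∈ sym d n)
    {x : Fin d → EuclideanSpace ℝ (Fin n)} (hx : x ∈ unitTuples d n)
    (h : |form A x| = spectralNorm A) {i j : Fin d} (hij : i ≠ j) :
    form A (update (update x i (x i + x j)) j (x i + x j)) =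
      form A x * ‖x i + x j‖ ^ 2 := by
  -- The form expands into four terms: the two repeated ones each give an inner product, the two
  -- mixed ones equal `form A x` by symmetry.
  have h1 : form A (update (update x i (x i)) j (x i)) = form A x * inner ℝ (x j) (x i) := by
    rw [update_eq_self]; exact form_update_of_abs_form_eq hd hx h j _
  have h2 : form A (update (update x i (x j)) j (x j)) = form A x * inner ℝ (x i) (x j) := by
    rw [update_comm hij, update_eq_self]; exact form_update_of_abs_form_eq hd hx h i _
  have h3 : form A (update (update x i (x j)) j (x i)) = form A x := by
    rw [← form_comp_perm hA (Equiv.swap i j) x]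
    congr 1
    rw [Equiv.comp_swap_eq_update, update_comm hij]
  have h4 : form A (update (update x i (x i)) j (x j)) = form A x := by
    rw [update_eq_self, update_eq_self]
  have hadd : ∀ z, form A (update (update x i (x i + x j)) j z) =
      form A (update (update x i (x i)) j z) + form A (update (update x i (x j)) j z) := fun z => by
    simp only [update_comm hij, (form A).map_update_add]
  rw [(form A).map_update_add, hadd, hadd, h1, h2, h3, h4, norm_add_sq_real, hx i, hx j,
    real_inner_comm (x i) (x j)]
  ring

/-- Banach's theorem: the spectral norm of a symmetric tensor is attained on the diagonal. -/
theorem exists_abs_form_const_eq (hd : 0 < d) (hn : 0 < n) {A : RealTensor d n}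
    (hA : A ∈ sym d n) :
    ∃ x : EuclideanSpace ℝ (Fin n), ‖x‖ = 1 ∧ |form A fun _ => x| = spectralNorm A := by
  have hcl : IsClosed {x | |form A x| = spectralNorm A} :=
    isClosed_eq (continuous_form A).abs continuous_const
  obtain ⟨x₀, hx₀, hs₀⟩ := exists_form_eq_spectralNorm hn A
  -- Among the maximizers, one with the longest sum of entries turns out to be constant.
  obtain ⟨x, ⟨hx, hs⟩, hmax⟩ := (isCompact_unitTuples.inter_right hcl).exists_isMaxOn
    ⟨x₀, hx₀, by simp [hs₀, abs_of_nonneg (spectralNorm_nonneg hd hn A)]⟩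
    (f := fun x : Fin d → EuclideanSpace ℝ (Fin n) => ‖∑ j, x j‖) (by fun_prop)
  have hmax' : ∀ y ∈ unitTuples d n, |form A y| = spectralNorm A →
      ‖∑ j, y j‖ ≤ ‖∑ j, x j‖ := fun y h1 h2 => hmax ⟨h1, h2⟩
  set S := ∑ j, x j with hS
  have hsum : ∀ (y : Fin d → EuclideanSpace ℝ (Fin n)) (j : Fin d) (z : EuclideanSpace ℝ (Fin n)),
      ∑ k, update y j z k = ∑ k, y k - y j + z := by
    intro y j z
    rw [Finset.sum_update_of_mem (Finset.mem_univ j),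
      Finset.sum_eq_sum_sdiff_singleton_add (Finset.mem_univ j) fun k => y k]
    abel
  -- Flipping the sign of `x j` keeps a maximizer, so it cannot lengthen the sum.
  have hpos : ∀ j, 0 < inner ℝ S (x j) := by
    intro j
    have h := hmax' (update x j ((-1 : ℝ) • x j)) (fun k => by
        rcases eq_or_ne k j with rfl | hk
        · simpa using hx _
        · simpa [hk] using hx k)
      (by rw [form_apply, outer_update_smul, real_inner_smul_right, abs_mul, ← form_apply, hs]
          simp)
    rw [hsum, ← hS, show S - x j + (-1 : ℝ) • x j = S - (2 : ℝ) • x j by module] at h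
    have h2 := pow_le_pow_left₀ (norm_nonneg _) h 2
    rw [norm_sub_sq_real, real_inner_smul_right, norm_smul, hx j] at h2
    norm_num at h2
    linarith
  -- Otherwise replace both entries by `u / ‖u‖`, `u = x i + x j`. This is still a maximizer, and
  -- since `‖u‖ < 2` the sum gains a positive multiple of `u`, so it gets longer.
  have hconst : ∀ i j, x i = x j := by
    intro i j
    by_contra hne
    have hij : i ≠ j := fun h => hne (by rw [h])
    have hu0 : 0 < inner ℝ S (x i + x j) := by
      rw [inner_add_right]; exact add_pos (hpos i) (hpos j)
    have hu : 0 < ‖x i + x j‖ := norm_pos_iff.2 fun h => by simp [h] at hu0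
    have hu2 : ‖x i + x j‖ < 2 := by
      have h1 : 0 < ‖x i - x j‖ := norm_pos_iff.2 (sub_ne_zero.2 hne)
      have h2 := parallelogram_law_with_norm ℝ (x i) (x j)
      rw [hx i, hx j] at h2
      nlinarith
    set u := x i + x j with hu_def
    set c := ‖u‖⁻¹ with hc
    have hc0 : 0 < c := inv_pos.2 hu
    have hcu : c * ‖u‖ = 1 := inv_mul_cancel₀ hu.ne'
    have h := hmax' (update (update x i (c • u)) j (c • u)) (fun k => by
        have : ‖c • u‖ = 1 := by rw [norm_smul, Real.norm_of_nonneg hc0.le, hcu]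
        rcases eq_or_ne k j with rfl | hk
        · simpa using this
        · rcases eq_or_ne k i with rfl | hk'
          · simpa [hk] using this
          · simpa [hk, hk'] using hx k)
      (by
        rw [(form A).map_update_smul, update_comm hij, (form A).map_update_smul,
          update_comm hij.symm, form_update_update_add hd hA hx hs hij, ← hs]
        congr 1
        simp only [smul_eq_mul]
        linear_combination (form A x * (c * ‖u‖ + 1)) * hcu)
    rw [hsum, hsum, update_of_ne hij.symm, ← hS,
      show S - x i + c • u - x j + c • u = S + (2 * c - 1) • u by rw [hu_def]; module] at h
    have h2 := pow_le_pow_left₀ (norm_nonneg _) h 2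
    rw [norm_add_sq_real, real_inner_smul_right] at h2
    have hc1 : 0 < 2 * c - 1 := by nlinarith
    nlinarith [mul_pos hc1 hu0, sq_nonneg ‖(2 * c - 1) • u‖]
  refine ⟨x ⟨0, hd⟩, hx _, ?_⟩
  rw [← hs]
  congr 2
  funext j
  exact hconst _ _

/-! ### Best rank-one approximations and extremal tensors -/

/-- For a unit tensor `u`, `‖A - s • u‖²` is least at `s = ⟨A, u⟩`, with value `‖A‖² - ⟨A, u⟩²`. -/
theorem isBestRankOneApprox_of_abs_form_eq (hd : 0 < d) (hn : 0 < n) {A : RealTensor d n}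
    (hA : A ≠ 0) {x : Fin d → EuclideanSpace ℝ (Fin n)} (hx : x ∈ unitTuples d n)
    (h : |form A x| = spectralNorm A) : IsBestRankOneApprox A (form A x • outer x) := by
  have hx1 := norm_outer_of_mem hx
  have hf : form A x ≠ 0 := abs_pos.1 (h ▸ spectralNorm_pos hd hn hA)
  refine ⟨⟨smul_ne_zero hf (norm_ne_zero_iff.1 (by rw [hx1]; exact one_ne_zero)), _,
    (outer_update_smul x ⟨0, hd⟩ _).symm⟩, ?_⟩
  rintro X ⟨hX, y, rfl⟩
  refine (pow_le_pow_iff_left₀ (norm_nonneg _) (norm_nonneg _) two_ne_zero).1 ?_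
  rw [outer_eq_norm_smul y, norm_sub_sq_real, norm_sub_sq_real, real_inner_smul_right,
    real_inner_smul_right, norm_smul, norm_smul, hx1, norm_outer_of_mem (normalize_mem_unitTuples hX),
    ← form_apply, ← form_apply]
  have h1 := abs_form_le_spectralNorm hd A (normalize_mem_unitTuples hX)
  rw [← h, ← sq_le_sq] at h1
  simp only [mul_one, Real.norm_eq_abs, sq_abs]
  nlinarith [sq_nonneg (‖outer y‖ - form A fun j => ‖y j‖⁻¹ • y j)]

theorem IsExtremalIn.spectralNorm_mul_le (hd : 0 < d) (hn : 0 < n)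
    {W : Submodule ℝ (RealTensor d n)} {A B : RealTensor d n} (hA : IsExtremalIn W A)
    (hB : B ∈ W) : spectralNorm A * ‖B‖ ≤ spectralNorm B * ‖A‖ := by
  obtain ⟨-, hA0, hA⟩ := hA
  rcases eq_or_ne B 0 with rfl | hB0
  · simpa using mul_nonneg (spectralNorm_nonneg hd hn _) (norm_nonneg A)
  rw [← div_le_div_iff₀ (norm_pos_iff.2 hA0) (norm_pos_iff.2 hB0), hA]
  refine csInf_le ⟨0, ?_⟩ ⟨B, hB, hB0, rfl⟩
  rintro t ⟨C, -, -, rfl⟩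
  exact div_nonneg (spectralNorm_nonneg hd hn C) (norm_nonneg C)

/-- If `f ≤ M` and `g` vanishes where `f = M`, then `f + t g < M + t m` for small `t > 0`. -/
theorem _root_.IsCompact.exists_forall_add_mul_lt {X : Type*} [TopologicalSpace X] {K : Set X}
    (hK : IsCompact K) {f g : X → ℝ} (hf : Continuous f) (hg : Continuous g) {M m : ℝ}
    (hm : 0 < m) (hM : ∀ x ∈ K, f x ≤ M) (h0 : ∀ x ∈ K, f x = M → g x = 0) :
    ∃ t > 0, ∀ x ∈ K, f x + t * g x < M + t * m := by
  -- Where `g < m` any `t > 0` works; on this compact remainder `f` stays a fixed gap below `M`.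
  have hL : IsCompact (K ∩ {x | m ≤ g x}) := hK.inter_right (isClosed_le continuous_const hg)
  rcases (K ∩ {x | m ≤ g x}).eq_empty_or_nonempty with he | hne
  · refine ⟨1, one_pos, fun x hx => ?_⟩
    have : g x < m := not_le.1 fun h => (he ▸ (⟨hx, h⟩ : x ∈ K ∩ {x | m ≤ g x}) : x ∈ (∅ : Set X))
    linarith [hM x hx]
  obtain ⟨y, ⟨hyK, hy⟩, hymax⟩ := hL.exists_isMaxOn hne hf.continuousOn
  obtain ⟨z, -, hzmax⟩ := hL.exists_isMaxOn hne hg.continuousOn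
  have hδ : 0 < M - f y :=
    sub_pos.2 ((hM y hyK).lt_of_ne fun h => (hm.trans_le hy).ne' (h0 y hyK h))
  have hG : 0 < |g z| + 1 := by positivity
  refine ⟨(M - f y) / (|g z| + 1), div_pos hδ hG, fun x hx => ?_⟩
  set t := (M - f y) / (|g z| + 1) with ht
  have ht0 : 0 < t := div_pos hδ hG
  rcases lt_or_ge (g x) m with h | h
  · nlinarith [hM x hx]
  · have h1 : f x ≤ f y := hymax ⟨hx, h⟩
    have h2 : g x ≤ g z := hzmax ⟨hx, h⟩
    have h3 : t * (|g z| + 1) = M - f y := div_mul_cancel₀ _ hG.ne'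
    nlinarith [le_abs_self (g z), mul_pos ht0 hm]

/-- A compact set of tuples of unit vectors at which the spectral norms of all elements of `W`
are attained. -/
structure IsNorming (W : Submodule ℝ (RealTensor d n))
    (T : Set (Fin d → EuclideanSpace ℝ (Fin n))) : Prop where
  isCompact : IsCompact T
  subset : T ⊆ unitTuples d n
  exists_eq : ∀ C ∈ W, ∃ x ∈ T, |form C x| = spectralNorm C

theorem isNorming_unitTuples (hd : 0 < d) (hn : 0 < n) : IsNorming ⊤ (unitTuples d n) := by
  refine ⟨isCompact_unitTuples, subset_rfl, fun C _ => ?_⟩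
  obtain ⟨x, hx, h⟩ := exists_form_eq_spectralNorm hn C
  exact ⟨x, hx, by rw [h, abs_of_nonneg (spectralNorm_nonneg hd hn C)]⟩

theorem isNorming_sym (hd : 0 < d) (hn : 0 < n) :
    IsNorming (sym d n) ((fun x _ => x) '' Metric.sphere (0 : EuclideanSpace ℝ (Fin n)) 1) := by
  refine ⟨(isCompact_sphere _ _).image (by fun_prop), ?_, fun C hC => ?_⟩
  · rintro _ ⟨x, hx, rfl⟩ j
    simpa using hx
  · obtain ⟨x, hx, h⟩ := exists_abs_form_const_eq hd hn hC
    exact ⟨_, ⟨x, by simpa using hx, rfl⟩, h⟩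

/-- First-order optimality of an extremal tensor. -/
theorem IsExtremalIn.inner_eq_zero (hd : 0 < d) (hn : 0 < n)
    {W : Submodule ℝ (RealTensor d n)} {T : Set (Fin d → EuclideanSpace ℝ (Fin n))}
    (hT : IsNorming W T) {A : RealTensor d n} (hA : IsExtremalIn W A) {B : RealTensor d n}
    (hB : B ∈ W) (h0 : ∀ x ∈ T, |form A x| = spectralNorm A → form B x = 0) :
    inner ℝ A B = 0 := by
  suffices key : ∀ B ∈ W, (∀ x ∈ T, |form A x| = spectralNorm A → form B x = 0) →
      inner ℝ A B ≤ 0 by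
    refine le_antisymm (key B hB h0) ?_
    have := key ((-1 : ℝ) • B) (W.smul_mem _ hB) fun x hx h => by
      rw [form_smul, h0 x hx h, mul_zero]
    rw [real_inner_smul_right] at this
    linarith
  intro B hB h0
  by_contra! hβ
  have hN : 0 < ‖A‖ := norm_pos_iff.2 hA.2.1
  have hs := spectralNorm_pos hd hn hA.2.1
  -- This `m` is the rate at which the spectral norm must grow to match the first-order growth of
  -- the Frobenius norm along `A + t • B`; growing slower beats the minimal ratio.
  obtain ⟨t, ht, hlt⟩ := hT.isCompact.exists_forall_add_mul_lt (continuous_form A).abs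
    (continuous_form B).abs (M := spectralNorm A) (m := spectralNorm A * inner ℝ A B / ‖A‖ ^ 2)
    (by positivity) (fun x hx => abs_form_le_spectralNorm hd A (hT.subset hx))
    (fun x hx h => by rw [h0 x hx h, abs_zero])
  have hC : A + t • B ∈ W := W.add_mem hA.1 (W.smul_mem _ hB)
  obtain ⟨x, hx, hxC⟩ := hT.exists_eq _ hC
  have h1 : spectralNorm (A + t • B) <
      spectralNorm A + t * (spectralNorm A * inner ℝ A B / ‖A‖ ^ 2) := by
    rw [← hxC, form_add, form_smul]
    refine (abs_add_le _ _).trans_lt ?_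
    rw [abs_mul, abs_of_pos ht]
    exact hlt x hx
  have h2 := hA.spectralNorm_mul_le hd hn hC
  have h3 : ‖A‖ ^ 2 + t * inner ℝ A B ≤ ‖A‖ * ‖A + t • B‖ := by
    refine le_trans (le_of_eq ?_) (real_inner_le_norm A (A + t • B))
    rw [inner_add_right, real_inner_smul_right, real_inner_self_eq_norm_sq]
  have h4 := mul_lt_mul_of_pos_right h1 (pow_pos hN 2)
  have h5 : (spectralNorm A + t * (spectralNorm A * inner ℝ A B / ‖A‖ ^ 2)) * ‖A‖ ^ 2 =
      spectralNorm A * (‖A‖ ^ 2 + t * inner ℝ A B) := by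
    field_simp
  rw [h5] at h4
  nlinarith [mul_le_mul_of_nonneg_left h3 hs.le, mul_le_mul_of_nonneg_right h2 hN.le]

/-- If the form of `A` vanishes as soon as the entry `i` or `j` is that of `w`, then adding
`‖A‖₂ • outer w` to `A` does not increase the spectral norm. -/
theorem spectralNorm_add_smul_outer_le (hd : 0 < d) (hn : 0 < n) {A : RealTensor d n}
    {w : Fin d → EuclideanSpace ℝ (Fin n)} (hw : w ∈ unitTuples d n) {i j : Fin d} (hij : i ≠ j)
    (hi : ∀ y, y i = w i → form A y = 0) (hj : ∀ y, y j = w j → form A y = 0) :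
    spectralNorm (A + spectralNorm A • outer w) ≤ spectralNorm A := by
  obtain ⟨x, hx, h⟩ := exists_form_eq_spectralNorm hn (A + spectralNorm A • outer w)
  have hs := spectralNorm_nonneg hd hn A
  have hsub : ∀ (k : Fin d), (∀ y, y k = w k → form A y = 0) →
      ∀ (y : Fin d → EuclideanSpace ℝ (Fin n)) (b : ℝ),
      form A (update y k (y k - b • w k)) = form A y := by
    intro k hk y b
    rw [(form A).map_update_sub, (form A).map_update_smul, update_eq_self,
      hk (update y k (w k)) (by simp)]
    simp
  -- The form of `A` only sees the components `p`, `q` orthogonal to `w`, while `outer w` only sees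
  -- the parallel ones; the bound is then `sin α sin β + cos α cos β ≤ 1`.
  set p := x i - (inner ℝ (w i) (x i) : ℝ) • w i with hp
  set q := x j - (inner ℝ (w j) (x j) : ℝ) • w j with hq
  have hA : form A x = form A (update (update x i p) j q) := by
    have h2 := hsub j hj (update x i p) (inner ℝ (w j) (x j))
    rw [update_of_ne hij.symm] at h2
    rw [h2, hp, hsub i hi]
  have hnorm : ∀ k, ‖x k - (inner ℝ (w k) (x k) : ℝ) • w k‖ ^ 2 +
      |inner ℝ (w k) (x k)| ^ 2 = 1 := by
    intro k
    rw [norm_sub_sq_real, real_inner_smul_right, norm_smul, hx k, hw k, real_inner_comm,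
      Real.norm_eq_abs, mul_one, sq_abs]
    ring
  have hother : ∀ k, |inner ℝ (w k) (x k)| ≤ 1 := fun k => by
    simpa [hw k, hx k] using abs_real_inner_le_norm (w k) (x k)
  have hsplit : ∀ f : Fin d → ℝ, ∏ k, f k = f i * (f j * ∏ k ∈ (univ.erase i).erase j, f k) :=
    fun f => by
      rw [mul_prod_erase _ f (by simp [hij.symm]), mul_prod_erase _ f (mem_univ i)]
  have h1 : form A x ≤ spectralNorm A * (‖p‖ * ‖q‖) := by
    refine (le_abs_self _).trans ?_
    rw [hA]
    refine (abs_form_le hd A _).trans (le_of_eq ?_)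
    rw [hsplit, prod_eq_one fun k hk => ?_]
    · simp [hij]
    · obtain ⟨hk1, hk2, -⟩ : k ≠ j ∧ k ≠ i ∧ True := by simpa using hk
      rw [update_of_ne hk1, update_of_ne hk2, hx k]
  have h2 : ∏ k, inner ℝ (w k) (x k) ≤ |inner ℝ (w i) (x i)| * |inner ℝ (w j) (x j)| := by
    refine (le_abs_self _).trans ?_
    rw [abs_prod, hsplit]
    refine mul_le_mul_of_nonneg_left (mul_le_of_le_one_right (abs_nonneg _) ?_) (abs_nonneg _)
    exact prod_le_one (fun _ _ => abs_nonneg _) fun k _ => hother k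
  have h3 : ‖p‖ * ‖q‖ + |inner ℝ (w i) (x i)| * |inner ℝ (w j) (x j)| ≤ 1 := by
    nlinarith [hnorm i, hnorm j, sq_nonneg (‖p‖ - ‖q‖),
      sq_nonneg (|inner ℝ (w i) (x i)| - |inner ℝ (w j) (x j)|)]
  rw [← h, form_add, form_smul, form_outer]
  nlinarith [mul_le_mul_of_nonneg_left h2 hs, mul_le_mul_of_nonneg_left h3 hs]

/-- An extremal tensor does not vanish on all tuples that share an entry with `w` when
`outer w ∈ W`. -/
theorem IsExtremalIn.false_of_form_eq_zero (hd : 2 ≤ d) (hn : 0 < n)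
    {W : Submodule ℝ (RealTensor d n)} {A : RealTensor d n} (hA : IsExtremalIn W A)
    {w : Fin d → EuclideanSpace ℝ (Fin n)} (hw : w ∈ unitTuples d n) (hwW : outer w ∈ W)
    (h : ∀ j y, y j = w j → form A y = 0) : False := by
  have hd0 : 0 < d := by omega
  have h1 := spectralNorm_add_smul_outer_le hd0 hn hw
    (i := ⟨0, hd0⟩) (j := ⟨1, hd⟩) (by simp) (h _) (h _)
  have h2 := hA.spectralNorm_mul_le hd0 hn (W.add_mem hA.1 (W.smul_mem (spectralNorm A) hwW))
  have hs := spectralNorm_pos hd0 hn hA.2.1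
  have h3 : ‖A + spectralNorm A • outer w‖ ≤ ‖A‖ :=
    le_of_mul_le_mul_left (h2.trans (mul_le_mul_of_nonneg_right h1 (norm_nonneg _))) hs
  have h4 := pow_le_pow_left₀ (norm_nonneg _) h3 2
  rw [norm_add_sq_real, real_inner_smul_right, ← form_apply, h ⟨0, hd0⟩ w rfl, norm_smul,
    norm_outer_of_mem hw, Real.norm_of_nonneg hs.le] at h4
  nlinarith

/-- Fewer than `n` tensors of rank one leave room for a unit vector orthogonal to their factors
in a given mode. -/
theorem exists_unit_orthogonal {S : Set (RealTensor d n)} (hS : S.encard < n)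
    (hS1 : ∀ Y ∈ S, IsRankOne Y) (j : Fin d) :
    ∃ v : EuclideanSpace ℝ (Fin n), ‖v‖ = 1 ∧
      ∀ x ∈ unitTuples d n, ∀ c : ℝ, c ≠ 0 → c • outer x ∈ S → inner ℝ (x j) v = 0 := by
  have hfin : S.Finite := Set.encard_ne_top_iff.1 (hS.trans (ENat.natCast_lt_top n)).ne
  choose! y hy using fun Y hY => (hS1 Y hY).2
  set F := hfin.toFinset.image fun Y => y Y j with hF
  have hcard : F.card < n := by
    refine card_image_le.trans_lt ?_
    rw [hfin.encard_eq_coe_toFinset_card] at hS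
    exact_mod_cast hS
  set V := Submodule.span ℝ (F : Set (EuclideanSpace ℝ (Fin n))) with hV
  have hVtop : V ≠ ⊤ := fun h => by
    have h1 := finrank_span_finset_le_card (R := ℝ) F
    rw [Set.finrank, ← hV, h, finrank_top, finrank_euclideanSpace_fin] at h1
    omega
  obtain ⟨u, hu, hu0⟩ := Submodule.exists_mem_ne_zero_of_ne_bot
    fun h => hVtop (Submodule.orthogonal_eq_bot_iff.1 h)
  refine ⟨‖u‖⁻¹ • u, by simp [norm_smul, hu0], fun x hx c hc hxS => ?_⟩
  rw [real_inner_smul_right]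
  refine mul_eq_zero_of_right _ ?_
  have h1 : inner ℝ (y (c • outer x) j) u = 0 :=
    (Submodule.mem_orthogonal _ _).1 hu _ (Submodule.subset_span
      (mem_coe.2 (mem_image_of_mem (fun Y => y Y j) (hfin.mem_toFinset.2 hxS))))
  -- The chosen factors `y` need not be those of `x`; evaluating both representations here gives `c
  -- * ⟨x j, u⟩ = 0`.
  have h2 : form (c • outer x) (update x j u) = form (outer (y (c • outer x))) (update x j u) := by
    rw [← hy _ hxS]
  rw [form_smul, form_outer, form_outer, prod_eq_single j, update_self,
    prod_eq_zero (mem_univ j) (by rw [update_self, h1])] at h2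
  · exact (mul_eq_zero.1 h2).resolve_left hc
  · intro k _ hk
    rw [update_of_ne hk, real_inner_self_eq_norm_sq, hx k, one_pow]
  · simp

theorem IsExtremalIn.le_encard_top (hd : 2 ≤ d) {A : RealTensor d n} (hA : IsExtremalIn ⊤ A) :
    (n : ℕ∞) ≤ {Y : RealTensor d n | IsBestRankOneApprox A Y}.encard := by
  by_contra! hlt
  have hd0 : 0 < d := by omega
  have hn : 0 < n := Nat.pos_of_ne_zero fun h => by simp [h] at hlt
  have hs := spectralNorm_pos hd0 hn hA.2.1
  choose v hv hvx using fun j => exists_unit_orthogonal hlt (fun Y hY => hY.1) j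
  refine hA.false_of_form_eq_zero hd hn hv Submodule.mem_top fun j y hy => ?_
  refine hA.inner_eq_zero hd0 hn (isNorming_unitTuples hd0 hn) (B := outer y) Submodule.mem_top
    fun x hx h => ?_
  rw [form_outer]
  refine prod_eq_zero (mem_univ j) ?_
  rw [hy, real_inner_comm]
  exact hvx j x hx _ (abs_pos.1 (h ▸ hs)) (isBestRankOneApprox_of_abs_form_eq hd0 hn hA.2.1 hx h)

theorem IsExtremalIn.le_encard_sym (hd : 2 ≤ d) {A : RealTensor d n}
    (hA : IsExtremalIn (sym d n) A) :
    (n : ℕ∞) ≤ {Y : RealTensor d n | IsBestRankOneApprox A Y ∧ Y ∈ sym d n}.encard := by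
  by_contra! hlt
  have hd0 : 0 < d := by omega
  have hn : 0 < n := Nat.pos_of_ne_zero fun h => by simp [h] at hlt
  have hs := spectralNorm_pos hd0 hn hA.2.1
  have hT := isNorming_sym hd0 hn
  obtain ⟨v, hv, hvx⟩ := exists_unit_orthogonal hlt (fun Y hY => hY.1.1) ⟨0, hd0⟩
  refine hA.false_of_form_eq_zero hd hn (w := fun _ => v) (fun _ => hv) (outer_const_mem_sym v)
    fun j y hy => ?_
  have h1 := hA.inner_eq_zero hd0 hn hT (sum_outer_comp_perm_mem_sym y) fun z hz h => by
    have hz1 := hT.subset hz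
    have hz0 := hvx z hz1 _ (abs_pos.1 (h ▸ hs))
      ⟨isBestRankOneApprox_of_abs_form_eq hd0 hn hA.2.1 hz1 h, by
        obtain ⟨x, -, rfl⟩ := hz
        exact (sym d n).smul_mem _ (outer_const_mem_sym x)⟩
    obtain ⟨x, -, rfl⟩ := hz
    rw [form_apply, sum_inner]
    refine sum_eq_zero fun σ _ => ?_
    rw [← form_apply, form_outer]
    refine prod_eq_zero (mem_univ (σ.symm j)) ?_
    rw [comp_apply, Equiv.apply_symm_apply, hy, real_inner_comm]
    exact hz0
  -- All permuted copies pair equally with the symmetric `A`, so `h1` says `d! * form A y = 0`.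
  have h2 : ∀ σ : Equiv.Perm (Fin d), inner ℝ A (outer (y ∘ σ)) = form A y :=
    fun σ => form_comp_perm hA.1 σ y
  rw [inner_sum, sum_congr rfl fun σ _ => h2 σ, sum_const, nsmul_eq_mul] at h1
  exact (mul_eq_zero.1 h1).resolve_left (by simp [Finset.card_univ, Fintype.card_ne_zero])

end RealTensor

/-- Extremal tensors have at least `n` distinct best rank-one approximations, and extremal
symmetric tensors have at least `n` distinct symmetric best rank-one approximations. -/
theorem mainTheorem12 (d n : ℕ) (hd : 2 ≤ d) :
    (∀ A : RealTensor d n, RealTensor.IsExtremalIn ⊤ A →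
      (n : ℕ∞) ≤ {Y : RealTensor d n | RealTensor.IsBestRankOneApprox A Y}.encard) ∧
    (∀ A : RealTensor d n, RealTensor.IsExtremalIn (RealTensor.sym d n) A →
      (n : ℕ∞) ≤ {Y : RealTensor d n |
        RealTensor.IsBestRankOneApprox A Y ∧ Y ∈ RealTensor.sym d n}.encard) := by
  exact ⟨fun _ hA => hA.le_encard_top hd, fun _ hA => hA.le_encard_sym hd⟩
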